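/- Let $d\in\mathbb N$, let $C\subset\mathbb{R}^d$ be closed and convex, and let $c(x,y)=|y-x|^2$ if $y-x\in C$ and $c(x,y)=+\infty$ otherwise. Let $f_0,f_1$ be Borel probability measures on $\mathbb{R}^d$ with $f_0$ absolutely continuous with respect to the Lebesgue measure, and assume that some $\pi\in\Pi(f_0,f_1)$ has finite cost $\int c\,d\pi<+\infty$, where $\Pi(f_0,f_1)$ denotes the set of measures on $\mathbb{R}^d\times\mathbb{R}^d$ with marginals $f_0$ and $f_1$. Let $\gamma$ be any minimizer of $\int c\,d\pi$ over $\pi\in\Pi(f_0,f_1)$. Definitions. A straight part of a convex set $D$ is a convex subset of $D$ with more than one point that is contained in the relative boundary of $D$; a maximal flat part of $D$ is a straight part that is maximal for inclusion. A flat part of $C$ is a set $F$ for which there is a finite chain $F=F_1\subset F_2\subset\dots\subset F_k=C$ ($k\ge 2$) of convex sets such that $F_i$ is a maximal flat part of $F_{i+1}$ for each $i<k$. The set $C$ is called strictly convex if it has no flat parts. 1. If $C$ is strictly convex, then $\gamma$ is concentrated on the graph of a Borel map $T:\mathbb{R}^d\to\mathbb{R}^d$, that is, $\gamma=(\mathrm{Id}\times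 T)_\sharp f_0$. 2. In general (whether or not $C$ is strictly convex), there are a $\sigma$-compact, $c$-cyclically monotone set $\Gamma\subset\{(x,y): y-x\in C\}$ on which $\gamma$ is concentrated, and a $\sigma$-compact set $R(\Gamma)\subset\Gamma$ on which $\gamma$ is also concentrated, such that: (a) for all $(x_0,y_0)\in R(\Gamma)$ and all $r>0$, the point $x_0$ is a Lebesgue (density) point of $\Gamma^{-1}(\overline{B(y_0,r)})=\{x:\ (x,y)\in\Gamma\text{ for some } y\in\overline{B(y_0,r)}\}$; (b) if $(x_0,y_0)$ and $(x_0,y_0')$ are in $R(\Gamma)$ and $y_0\neq y_0'$, then $y_0-x_0$ and $y_0'-x_0$ belong to a common flat part of $C$. -/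

import Mathlib

open MeasureTheory Set Filter Topology
open scoped ENNReal

namespace ConstrainedTransport

/-- The Euclidean space of dimension `d`. -/
abbrev E (d : ℕ) := EuclideanSpace ℝ (Fin d)

/-! ### Flat parts of convex sets -/

section Convexity

variable {d : ℕ}

/-- A straight part of `C`: a convex subset with more than one point that is contained in
the relative boundary of `C`. -/
def IsStraightPart (F C : Set (E d)) : Prop :=
  Convex ℝ F ∧ F.Nontrivial ∧ F ⊆ C ∧ F ⊆ intrinsicFrontier ℝ C

/-- A maximal flat part of `C`: a straight part that is maximal for the inclusion. -/
def IsMaximalFlatPart (F C : Set (E d)) : Prop :=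
  Maximal (fun S => IsStraightPart S C) F

/-- A flat part of `C`: the bottom `F = F₁` of a finite chain `F₁ ⊆ F₂ ⊆ ⋯ ⊆ F_k = C` with `k ≥ 2`
in which every `F_i` is a maximal flat part of `F_{i+1}`. (The `F_i` with `i < k` are convex,
since straight parts are.) -/
def IsFlatPart (F C : Set (E d)) : Prop :=
  Relation.TransGen IsMaximalFlatPart F C

/-- A set without flat parts. Unlike Mathlib's `StrictConvex`, this refers to the relative
boundary, not to the topological interior. -/
def HasNoFlatPart (C : Set (E d)) : Prop :=
  ∀ F : Set (E d), ¬ IsFlatPart F C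

end Convexity

/-! ### The transport problem -/

section Transport

variable {d : ℕ}

open Classical in
/-- The cost `c(x, y) = |y - x|²` if `y - x ∈ C`, and `+∞` otherwise. -/
noncomputable def cost (C : Set (E d)) (x y : E d) : ℝ≥0∞ :=
  if y - x ∈ C then ENNReal.ofReal (‖y - x‖ ^ 2) else ⊤

/-- `π` is a transport plan between `f₀` and `f₁`: its marginals are `f₀` and `f₁`. -/
def IsPlan (f₀ f₁ : Measure (E d)) (π : Measure (E d × E d)) : Prop :=
  π.map Prod.fst = f₀ ∧ π.map Prod.snd = f₁

/-- The total cost of a plan. -/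
noncomputable def totalCost (C : Set (E d)) (π : Measure (E d × E d)) : ℝ≥0∞ :=
  ∫⁻ p, cost C p.1 p.2 ∂π

/-- `γ` solves the Kantorovich problem: it minimizes the total cost among all plans. -/
def IsOptimalPlan (C : Set (E d)) (f₀ f₁ : Measure (E d)) (γ : Measure (E d × E d)) : Prop :=
  IsPlan f₀ f₁ γ ∧ ∀ π : Measure (E d × E d), IsPlan f₀ f₁ π → totalCost C γ ≤ totalCost C π

/-- `γ` is concentrated on the graph of a Borel map `T`; equivalently it is the image
of its first marginal `f₀` under `x ↦ (x, T x)`. -/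
def IsConcentratedOnGraph (f₀ : Measure (E d)) (γ : Measure (E d × E d)) : Prop :=
  ∃ T : E d → E d, Measurable T ∧ (∀ᵐ p ∂γ, p.2 = T p.1) ∧ γ = f₀.map (fun x => (x, T x))

end Transport

/-! ### Cyclically monotone sets and their Lebesgue points -/

section Monotone

variable {d : ℕ}

/-- `Γ` is cyclically monotone for the cost `c`. -/
def IsCyclicallyMonotone (c : E d → E d → ℝ≥0∞) (Γ : Set (E d × E d)) : Prop :=
  ∀ (n : ℕ) (p : Fin n → E d × E d), (∀ i, p i ∈ Γ) → ∀ σ : Equiv.Perm (Fin n),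
    ∑ i, c (p i).1 (p i).2 ≤ ∑ i, c (p i).1 (p (σ i)).2

/-- `γ` is concentrated on the σ-compact, cyclically monotone set `Γ`, all of whose points `(x, y)`
have their displacement `y - x` in `C`. -/
structure IsMonotoneSupport (C : Set (E d)) (γ : Measure (E d × E d)) (Γ : Set (E d × E d)) :
    Prop where
  sigmaCompact : IsSigmaCompact Γ
  concentrated : γ Γᶜ = 0
  displacement : ∀ p ∈ Γ, p.2 - p.1 ∈ C
  cyclic : IsCyclicallyMonotone (cost C) Γ

/-- `Γ⁻¹(B)`: the projection on the first factor of `Γ ∩ (ℝᵈ × B)`. -/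
def preimageOf (Γ : Set (E d × E d)) (B : Set (E d)) : Set (E d) :=
  Prod.fst '' (Γ ∩ (univ ×ˢ B))

/-- `x` is a Lebesgue (density) point of `A`. -/
def IsLebesguePoint (A : Set (E d)) (x : E d) : Prop :=
  Tendsto (fun ε : ℝ => volume (A ∩ Metric.ball x ε) / volume (Metric.ball x ε))
    (𝓝[>] 0) (𝓝 1)

/-- `R` is a σ-compact subset of `Γ` on which `γ` is concentrated, and for all `(x, y) ∈ R` and
`r > 0` the point `x` is a Lebesgue point of `Γ⁻¹` of the closed ball of radius `r` at `y`. -/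
structure IsLebesgueSupport (γ : Measure (E d × E d)) (Γ R : Set (E d × E d)) : Prop where
  subset : R ⊆ Γ
  sigmaCompact : IsSigmaCompact R
  concentrated : γ Rᶜ = 0
  lebesgue : ∀ p ∈ R, ∀ r : ℝ, 0 < r →
    IsLebesguePoint (preimageOf Γ (Metric.closedBall p.2 r)) p.1

end Monotone

end ConstrainedTransport

/-! The plan `γ` lives on a cyclically monotone set `Γ`. Because the cost takes the value `⊤`,
attainment in the dual problem is not used: Kantorovich duality (`DualBound.exists_plan`, by
Hahn–Banach and Riesz) yields bounded continuous admissible potentials whose gaps have `γ`-integral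
at most `2⁻ᵏ`, and `Γ` is taken where these gaps tend to zero.

Suppose that distinct displacements `p`, `q` occur at the same `x₀` and that the segment `[p, q]`
meets the relative interior of `C`. Then its midpoint is relatively interior too. Let `w` be close
to `q - p` and suppose that, for a small `ε > 0`, `Γ` sends `x₀ + εw` near `x₀ + p`. Exchanging the
targets of `x₀` and `x₀ + εw` keeps both displacements in `C`, thanks to the room around the
midpoint, and changes the cost by about `-2ε|q - p|²`, a contradiction (`false_of_ball_midpoint`).
So the segment is a straight part, and Zorn's lemma puts it in a maximal flat part.

The points `x₀ + εw` come from a recurrence property weaker than density: almost every point of a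
measurable set returns to it along small positive multiples of a fixed `w`
(`ae_exists_small_translate_mem`). Countably many balls and directions suffice, and `f₀ ≪ volume`
carries the null sets over to `γ`. If there are no flat parts, the fibres of `R` are single points
and `γ` is carried by a graph. -/

namespace ConstrainedTransport

/-! ### Kantorovich duality by Hahn–Banach and Riesz -/

section Duality

open scoped BoundedContinuousFunction CompactlySupported

variable {X : Type*} [MetricSpace X]

/-- `u ≤ φ ⊕ ψ + t c`. -/
def IsMajorant (c : X × X → ℝ≥0∞) (u : X × X →ᵇ ℝ) (φ ψ : X →ᵇ ℝ) (t : ℝ) : Prop :=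
  0 ≤ t ∧ ∀ p, ENNReal.ofReal (u p - φ p.1 - ψ p.2) ≤ ENNReal.ofReal t * c p

lemma IsMajorant.add {c : X × X → ℝ≥0∞} {u u' : X × X →ᵇ ℝ} {φ ψ φ' ψ' : X →ᵇ ℝ} {t t' : ℝ}
    (h : IsMajorant c u φ ψ t) (h' : IsMajorant c u' φ' ψ' t') :
    IsMajorant c (u + u') (φ + φ') (ψ + ψ') (t + t') := by
  refine ⟨add_nonneg h.1 h'.1, fun p => ?_⟩
  rw [ENNReal.ofReal_add h.1 h'.1, add_mul]
  refine le_trans ?_ (add_le_add (h.2 p) (h'.2 p))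
  refine le_trans (le_of_eq ?_) ENNReal.ofReal_add_le
  congr 1
  simp only [BoundedContinuousFunction.coe_add, Pi.add_apply]
  ring

lemma IsMajorant.smul {c : X × X → ℝ≥0∞} {u : X × X →ᵇ ℝ} {φ ψ : X →ᵇ ℝ} {t : ℝ}
    (h : IsMajorant c u φ ψ t) {a : ℝ} (ha : 0 ≤ a) :
    IsMajorant c (a • u) (a • φ) (a • ψ) (a * t) := by
  refine ⟨mul_nonneg ha h.1, fun p => ?_⟩
  rw [ENNReal.ofReal_mul ha, mul_assoc]
  refine le_trans (le_of_eq ?_) (mul_le_mul_right (h.2 p) (ENNReal.ofReal a))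
  rw [← ENNReal.ofReal_mul ha]
  congr 1
  simp only [BoundedContinuousFunction.coe_smul, smul_eq_mul]
  ring

lemma isMajorant_norm (c : X × X → ℝ≥0∞) (u : X × X →ᵇ ℝ) :
    IsMajorant c u (BoundedContinuousFunction.const X ‖u‖) 0 0 := by
  refine ⟨le_rfl, fun p => ?_⟩
  have : u p ≤ ‖u‖ := (le_abs_self _).trans (u.norm_coe_le_norm p)
  rw [ENNReal.ofReal_eq_zero.2 (by simpa using this)]
  exact zero_le

/-- A cutoff function equal to `1` near `x₀` and vanishing outside of a ball. -/
noncomputable def cutoff (x₀ : X) (n : ℕ) : X →ᵇ ℝ :=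
  BoundedContinuousFunction.ofNormedAddCommGroup (fun x => max 0 (min 1 (n - dist x x₀)))
    (by fun_prop) 1 fun x => by
      rw [Real.norm_eq_abs, abs_of_nonneg (le_max_left _ _)]
      exact max_le zero_le_one (min_le_left _ _)

lemma cutoff_apply (x₀ : X) (n : ℕ) (x : X) :
    cutoff x₀ n x = max 0 (min 1 (n - dist x x₀)) := rfl

lemma cutoff_nonneg (x₀ : X) (n : ℕ) (x : X) : 0 ≤ cutoff x₀ n x := le_max_left _ _

lemma cutoff_le_one (x₀ : X) (n : ℕ) (x : X) : cutoff x₀ n x ≤ 1 :=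
  max_le zero_le_one (min_le_left _ _)

lemma cutoff_mono (x₀ x : X) : Monotone fun n => cutoff x₀ n x := by
  intro n k h
  simp only [cutoff_apply]
  gcongr

lemma tendsto_cutoff (x₀ x : X) : Tendsto (fun n => cutoff x₀ n x) atTop (𝓝 1) := by
  refine tendsto_const_nhds.congr' ?_
  filter_upwards [eventually_ge_atTop ⌈1 + dist x x₀⌉₊] with n hn
  have : 1 + dist x x₀ ≤ n := Nat.ceil_le.1 hn
  rw [cutoff_apply, min_eq_left (by linarith), max_eq_right zero_le_one]

lemma cutoff_eq_zero {x₀ x : X} {n : ℕ} (h : x ∉ Metric.closedBall x₀ n) :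
    cutoff x₀ n x = 0 := by
  rw [Metric.mem_closedBall, not_le] at h
  rw [cutoff_apply, max_eq_left]
  exact (min_le_right _ _).trans (by linarith)

variable [MeasurableSpace X]

/-- The values of the majorants of `u`. -/
def majorantValues (μ ν : Measure X) (c : X × X → ℝ≥0∞) (m : ℝ) (u : X × X →ᵇ ℝ) : Set ℝ :=
  {s | ∃ φ ψ t, IsMajorant c u φ ψ t ∧ ∫ x, φ x ∂μ + ∫ y, ψ y ∂ν + t * m = s}

lemma majorantValues_nonempty (μ ν : Measure X) (c : X × X → ℝ≥0∞) (m : ℝ) (u : X × X →ᵇ ℝ) :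
    (majorantValues μ ν c m u).Nonempty :=
  ⟨_, _, _, _, isMajorant_norm c u, rfl⟩

variable [BorelSpace X]

variable (μ ν : Measure X) [IsProbabilityMeasure μ] [IsProbabilityMeasure ν]

/-- Every pair of bounded continuous functions with `φ ⊕ ψ ≤ c` has dual value at most `m`. -/
def DualBound (c : X × X → ℝ≥0∞) (m : ℝ) : Prop :=
  ∀ φ ψ : X →ᵇ ℝ, (∀ p : X × X, ENNReal.ofReal (φ p.1 + ψ p.2) ≤ c p) →
    ∫ x, φ x ∂μ + ∫ y, ψ y ∂ν ≤ m

variable {μ ν}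

lemma integral_add_integral_nonneg {φ ψ : X →ᵇ ℝ} (h : ∀ x y, 0 ≤ φ x + ψ y) :
    0 ≤ ∫ x, φ x ∂μ + ∫ y, ψ y ∂ν := by
  have h1 : ∀ x, 0 ≤ φ x + ∫ y, ψ y ∂ν := fun x => by
    have : 0 ≤ ∫ y, (φ x + ψ y) ∂ν := integral_nonneg fun y => h x y
    rwa [integral_add (integrable_const _) (ψ.integrable ν), integral_const, probReal_univ,
      one_smul] at this
  have : 0 ≤ ∫ x, (φ x + ∫ y, ψ y ∂ν) ∂μ := integral_nonneg h1
  rwa [integral_add (φ.integrable μ) (integrable_const _), integral_const, probReal_univ,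
    one_smul] at this

/-- For `t > 0` the pair `(-φ/t, -ψ/t)` is admissible in the dual problem. This is the consistency
condition that Hahn–Banach needs at `u = 0`. -/
lemma DualBound.majorant_nonneg {c : X × X → ℝ≥0∞} {m : ℝ} (H : DualBound μ ν c m)
    {φ ψ : X →ᵇ ℝ} {t : ℝ} (h : IsMajorant c 0 φ ψ t) :
    0 ≤ ∫ x, φ x ∂μ + ∫ y, ψ y ∂ν + t * m := by
  rcases h.1.eq_or_lt with rfl | ht
  -- Since `0 * ⊤ = 0`, a majorant with `t = 0` dominates everywhere, even where `c` is infinite.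
  · have := integral_add_integral_nonneg (μ := μ) (ν := ν) (φ := φ) (ψ := ψ) fun x y => by
      have := h.2 (x, y)
      simp only [ENNReal.ofReal_zero, zero_mul, nonpos_iff_eq_zero, ENNReal.ofReal_eq_zero] at this
      simp only [BoundedContinuousFunction.coe_zero, Pi.zero_apply] at this
      linarith
    simpa using this
  · have h1 := H ((-t⁻¹) • φ) ((-t⁻¹) • ψ) fun p => by
      have h2 := (h.smul (inv_nonneg.2 ht.le)).2 p
      rw [inv_mul_cancel₀ ht.ne', ENNReal.ofReal_one, one_mul] at h2
      refine le_trans (le_of_eq ?_) h2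
      congr 1
      simp
      ring
    simp only [BoundedContinuousFunction.coe_smul, smul_eq_mul, integral_const_mul] at h1
    have h2 := mul_le_mul_of_nonneg_left h1 ht.le
    have h3 : t * (-t⁻¹ * ∫ x, φ x ∂μ + -t⁻¹ * ∫ y, ψ y ∂ν)
        = -(∫ x, φ x ∂μ + ∫ y, ψ y ∂ν) := by field_simp; ring
    rw [h3] at h2
    linarith

lemma DualBound.bddBelow {c : X × X → ℝ≥0∞} {m : ℝ} (H : DualBound μ ν c m)
    (u : X × X →ᵇ ℝ) : BddBelow (majorantValues μ ν c m u) := by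
  refine ⟨-‖u‖, ?_⟩
  rintro _ ⟨φ, ψ, t, h, rfl⟩
  have h1 := H.majorant_nonneg (by simpa using h.add (isMajorant_norm c (-u)))
  simp only [BoundedContinuousFunction.coe_add, Pi.add_apply] at h1
  rw [integral_add (φ.integrable μ) (BoundedContinuousFunction.integrable μ _)] at h1
  simp at h1
  linarith

/-- The Hahn–Banach step: a linear functional dominated by the values of all majorants. -/
lemma DualBound.exists_functional {c : X × X → ℝ≥0∞} {m : ℝ} (H : DualBound μ ν c m) :
    ∃ L : (X × X →ᵇ ℝ) →ₗ[ℝ] ℝ, ∀ u φ ψ t, IsMajorant c u φ ψ t →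
      L u ≤ ∫ x, φ x ∂μ + ∫ y, ψ y ∂ν + t * m := by
  have key : ∀ (a : ℝ), 0 < a → ∀ u, sInf (majorantValues μ ν c m (a • u)) ≤
      a * sInf (majorantValues μ ν c m u) := by
    intro a ha u
    rw [← div_le_iff₀' ha]
    refine le_csInf (majorantValues_nonempty μ ν c m u) ?_
    rintro _ ⟨φ, ψ, t, h, rfl⟩
    rw [div_le_iff₀' ha]
    refine csInf_le (H.bddBelow _) ⟨_, _, _, h.smul ha.le, ?_⟩
    simp only [BoundedContinuousFunction.coe_smul, smul_eq_mul, integral_const_mul]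
    ring
  -- The infimum of the majorant values is sublinear; the functional extended is the zero one on the
  -- trivial subspace.
  have ext := exists_extension_of_le_sublinear (E := X × X →ᵇ ℝ) ⊥
    (fun u => sInf (majorantValues μ ν c m u)) ?_ ?_ ?_
  · obtain ⟨L, -, hL⟩ := ext
    exact ⟨L, fun u φ ψ t h => (hL u).trans (csInf_le (H.bddBelow u) ⟨φ, ψ, t, h, rfl⟩)⟩
  · intro a ha u
    refine le_antisymm (key a ha u) ?_
    have := key a⁻¹ (inv_pos.2 ha) (a • u)
    rw [inv_smul_smul₀ ha.ne', ← div_eq_inv_mul, le_div_iff₀' ha] at this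
    exact this
  · intro u v
    rw [← sub_le_iff_le_add]
    refine le_csInf (majorantValues_nonempty μ ν c m u) ?_
    rintro _ ⟨φ, ψ, t, h, rfl⟩
    rw [sub_le_comm]
    refine le_csInf (majorantValues_nonempty μ ν c m v) ?_
    rintro _ ⟨φ', ψ', t', h', rfl⟩
    rw [sub_le_iff_le_add]
    refine csInf_le (H.bddBelow _) ⟨_, _, _, h.add h', ?_⟩
    simp only [BoundedContinuousFunction.coe_add, Pi.add_apply]
    rw [integral_add (φ.integrable μ) (φ'.integrable μ),
      integral_add (ψ.integrable ν) (ψ'.integrable ν)]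
    ring
  · rintro ⟨x, hx⟩
    obtain rfl : x = 0 := (Submodule.mem_bot ℝ).1 hx
    refine le_csInf (majorantValues_nonempty μ ν c m _) ?_
    rintro _ ⟨φ, ψ, t, h, rfl⟩
    exact H.majorant_nonneg h

lemma tendsto_integral_one_sub_cutoff (μ : Measure X) [IsProbabilityMeasure μ] (x₀ : X) :
    Tendsto (fun n => ∫ x, (1 - cutoff x₀ n x) ∂μ) atTop (𝓝 0) := by
  have := tendsto_integral_of_dominated_convergence (μ := μ) (F := fun n x => 1 - cutoff x₀ n x)
    (f := fun _ => 0) (fun _ => (1 : ℝ))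
    (fun n => by fun_prop) (integrable_const _)
    (fun n => Eventually.of_forall fun x => by
      rw [Real.norm_eq_abs, abs_of_nonneg (sub_nonneg.2 (cutoff_le_one x₀ n x))]
      linarith [cutoff_nonneg x₀ n x])
    (Eventually.of_forall fun x => by simpa using (tendsto_cutoff x₀ x).const_sub 1)
  simpa using this

/-- A positive functional with marginals `μ` and `ν` is represented by a measure. -/
lemma exists_measure_of_functional [ProperSpace X] (L : (X × X →ᵇ ℝ) →ₗ[ℝ] ℝ)
    (hneg : ∀ u, (∀ p, u p ≤ 0) → L u ≤ 0)
    (hmaj : ∀ u (φ ψ : X →ᵇ ℝ), (∀ p, u p ≤ φ p.1 + ψ p.2) →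
      L u ≤ ∫ x, φ x ∂μ + ∫ y, ψ y ∂ν) :
    ∃ π : Measure (X × X), ∀ u : X × X →ᵇ ℝ, (∀ p, 0 ≤ u p) →
      ∫⁻ p, ENNReal.ofReal (u p) ∂π = ENNReal.ofReal (L u) := by
  have hpos : ∀ u, (∀ p, 0 ≤ u p) → 0 ≤ L u := fun u hu => by
    have := hneg (-u) fun p => by simpa using hu p
    simpa using this
  let Λ : C_c(X × X, ℝ) →ₚ[ℝ] ℝ := PositiveLinearMap.mk₀
    { toFun := fun f => L f.toBoundedContinuousFunction
      map_add' := fun f g => by rw [← map_add]; rfl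
      map_smul' := fun a f => by rw [← map_smul]; rfl }
    (fun f hf => hpos _ fun p => hf p)
  have hΛ : ∀ f : C_c(X × X, ℝ), Λ f = L f.toBoundedContinuousFunction := fun f => rfl
  refine ⟨RealRMK.rieszMeasure Λ, fun u hu => ?_⟩
  obtain ⟨x₀⟩ : Nonempty X := μ.nonempty_of_neZero
  let χ : ℕ → X × X →ᵇ ℝ := fun n =>
    (cutoff x₀ n).compContinuous ⟨Prod.fst, continuous_fst⟩ *
      (cutoff x₀ n).compContinuous ⟨Prod.snd, continuous_snd⟩
  have χ_apply : ∀ n p, χ n p = cutoff x₀ n p.1 * cutoff x₀ n p.2 := fun n p => rfl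
  have hsupp : ∀ n, HasCompactSupport (χ n * u) := fun n =>
    HasCompactSupport.intro ((isCompact_closedBall x₀ n).prod (isCompact_closedBall x₀ n))
      fun p hp => by
        rw [BoundedContinuousFunction.coe_mul, Pi.mul_apply, χ_apply]
        rw [mem_prod, not_and_or] at hp
        rcases hp with hp | hp <;> simp [cutoff_eq_zero hp]
  have h1 : ∀ n, ∫⁻ p, ENNReal.ofReal ((χ n * u) p) ∂(RealRMK.rieszMeasure Λ)
      = ENNReal.ofReal (L (χ n * u)) := fun n => by
    have h := RealRMK.integral_rieszMeasure Λ
      (⟨(χ n * u).toContinuousMap, hsupp n⟩ : C_c(X × X, ℝ))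
    rw [hΛ] at h
    have e : (⟨(χ n * u).toContinuousMap, hsupp n⟩ : C_c(X × X, ℝ)).toBoundedContinuousFunction
      = χ n * u := rfl
    rw [e] at h
    rw [← h, ofReal_integral_eq_lintegral_ofReal]
    · rfl
    · exact (χ n * u).continuous.integrable_of_hasCompactSupport (hsupp n)
    · exact Eventually.of_forall fun p => mul_nonneg
        (mul_nonneg (cutoff_nonneg _ _ _) (cutoff_nonneg _ _ _)) (hu p)
  have h2 : Tendsto (fun n => L (χ n * u)) atTop (𝓝 (L u)) := by
    have hz : Tendsto (fun n => ‖u‖ * (∫ x, (1 - cutoff x₀ n x) ∂μ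
        + ∫ x, (1 - cutoff x₀ n x) ∂ν)) atTop (𝓝 0) := by
      simpa using ((tendsto_integral_one_sub_cutoff μ x₀).add
        (tendsto_integral_one_sub_cutoff ν x₀)).const_mul ‖u‖
    -- No mass escapes to infinity: `1 - ab ≤ (1 - a) + (1 - b)` bounds the loss by the tails of the
    -- two marginals.
    have hb : ∀ n, L u - L (χ n * u) ≤ ‖u‖ * (∫ x, (1 - cutoff x₀ n x) ∂μ
        + ∫ x, (1 - cutoff x₀ n x) ∂ν) := fun n => by
      rw [← map_sub]
      refine (hmaj _ (‖u‖ • (1 - cutoff x₀ n)) (‖u‖ • (1 - cutoff x₀ n)) fun p => ?_).trans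
        (le_of_eq ?_)
      · simp only [BoundedContinuousFunction.coe_sub, BoundedContinuousFunction.coe_mul,
          BoundedContinuousFunction.coe_smul, BoundedContinuousFunction.coe_one, Pi.sub_apply,
          Pi.mul_apply, Pi.one_apply, smul_eq_mul, χ_apply]
        have a0 := cutoff_le_one x₀ n p.1
        have b0 := cutoff_le_one x₀ n p.2
        have a1 := cutoff_nonneg x₀ n p.1
        have : u p ≤ ‖u‖ := (le_abs_self _).trans (u.norm_coe_le_norm p)
        have hab : cutoff x₀ n p.1 * cutoff x₀ n p.2 ≤ 1 := mul_le_one₀ a0 (cutoff_nonneg _ _ _) b0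
        calc u p - cutoff x₀ n p.1 * cutoff x₀ n p.2 * u p
            = u p * (1 - cutoff x₀ n p.1 * cutoff x₀ n p.2) := by ring
          _ ≤ ‖u‖ * (1 - cutoff x₀ n p.1 * cutoff x₀ n p.2) :=
            mul_le_mul_of_nonneg_right this (by linarith)
          _ ≤ ‖u‖ * ((1 - cutoff x₀ n p.1) + (1 - cutoff x₀ n p.2)) :=
            mul_le_mul_of_nonneg_left
              (by nlinarith [mul_nonneg (sub_nonneg.2 a0) (sub_nonneg.2 b0)]) (norm_nonneg u)
          _ = _ := by ring
      · simp only [BoundedContinuousFunction.coe_sub, BoundedContinuousFunction.coe_smul,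
          BoundedContinuousFunction.coe_one, Pi.sub_apply, Pi.one_apply, smul_eq_mul,
          integral_const_mul]
        ring
    have ha : ∀ n, 0 ≤ L u - L (χ n * u) := fun n => by
      rw [← map_sub]
      refine hpos _ fun p => ?_
      simp only [BoundedContinuousFunction.coe_sub, BoundedContinuousFunction.coe_mul,
          Pi.sub_apply, Pi.mul_apply, χ_apply]
      have := mul_le_one₀ (cutoff_le_one x₀ n p.1) (cutoff_nonneg _ _ _) (cutoff_le_one x₀ n p.2)
      nlinarith [hu p]
    have := (squeeze_zero ha hb hz).const_sub (L u)
    simpa using this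
  have h3 : Tendsto (fun n => ∫⁻ p, ENNReal.ofReal ((χ n * u) p) ∂(RealRMK.rieszMeasure Λ)) atTop
      (𝓝 (∫⁻ p, ENNReal.ofReal (u p) ∂(RealRMK.rieszMeasure Λ))) := by
    refine lintegral_tendsto_of_tendsto_of_monotone
      (fun n => (ENNReal.continuous_ofReal.comp (χ n * u).continuous).measurable.aemeasurable)
      (Eventually.of_forall fun p n k hnk => ENNReal.ofReal_le_ofReal ?_)
      (Eventually.of_forall fun p => ENNReal.tendsto_ofReal ?_)
    · exact mul_le_mul_of_nonneg_right (mul_le_mul (cutoff_mono _ _ hnk) (cutoff_mono _ _ hnk)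
        (cutoff_nonneg _ _ _) (cutoff_nonneg _ _ _)) (hu p)
    · simpa [χ_apply] using
        ((tendsto_cutoff x₀ p.1).mul (tendsto_cutoff x₀ p.2)).mul_const (u p)
  simp_rw [h1] at h3
  exact tendsto_nhds_unique h3 (ENNReal.tendsto_ofReal h2)

lemma map_eq_of_functional [SecondCountableTopology X] (L : (X × X →ᵇ ℝ) →ₗ[ℝ] ℝ)
    {π : Measure (X × X)} [IsFiniteMeasure π]
    (hπ : ∀ u : X × X →ᵇ ℝ, (∀ p, 0 ≤ u p) →
      ∫⁻ p, ENNReal.ofReal (u p) ∂π = ENNReal.ofReal (L u))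
    {g : X × X → X} (hg : Continuous g)
    (h : ∀ φ : X →ᵇ ℝ, L (φ.compContinuous ⟨g, hg⟩) = ∫ x, φ x ∂μ) : π.map g = μ := by
  refine ext_of_forall_lintegral_eq_of_IsFiniteMeasure fun f => ?_
  let φ : X →ᵇ ℝ := ⟨⟨fun x => (f x : ℝ), NNReal.continuous_coe.comp f.continuous⟩, f.map_bounded'⟩
  have hφ : ∀ x, (f x : ℝ≥0∞) = ENNReal.ofReal (φ x) := fun x => by
    change _ = ENNReal.ofReal (f x : ℝ)
    rw [ENNReal.ofReal_coe_nnreal]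
  have h0 : ∀ x, 0 ≤ φ x := fun x => NNReal.coe_nonneg _
  have h1 := hπ (φ.compContinuous ⟨g, hg⟩) fun p => h0 _
  rw [h, ofReal_integral_eq_lintegral_ofReal (φ.integrable μ) (Eventually.of_forall h0)] at h1
  simp_rw [hφ]
  rw [lintegral_map (by fun_prop) hg.measurable]
  exact h1

/-- Kantorovich duality: a bound on the dual problem gives a plan whose cost, tested with
bounded continuous functions below `c`, satisfies the same bound. -/
theorem DualBound.exists_plan [ProperSpace X] {c : X × X → ℝ≥0∞} {m : ℝ}
    (H : DualBound μ ν c m) :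
    ∃ π : Measure (X × X), π.map Prod.fst = μ ∧ π.map Prod.snd = ν ∧
      ∀ u : X × X →ᵇ ℝ, (∀ p, 0 ≤ u p) → (∀ p, ENNReal.ofReal (u p) ≤ c p) →
        ∫⁻ p, ENNReal.ofReal (u p) ∂π ≤ ENNReal.ofReal m := by
  obtain ⟨L, hL⟩ := H.exists_functional
  -- Majorants with `t = 0` control positivity, mass and marginals; the majorant `(0, 0, 1)`
  -- controls the cost at the end.
  have hmaj : ∀ u (φ ψ : X →ᵇ ℝ), (∀ p, u p ≤ φ p.1 + ψ p.2) →
      L u ≤ ∫ x, φ x ∂μ + ∫ y, ψ y ∂ν := fun u φ ψ h => by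
    simpa using hL u φ ψ 0 ⟨le_rfl, fun p => by
      rw [ENNReal.ofReal_eq_zero.2 (by linarith [h p])]; exact zero_le⟩
  obtain ⟨π, hπ⟩ := exists_measure_of_functional L
    (fun u hu => by simpa using hmaj u 0 0 fun p => by simpa using hu p) hmaj
  have hone : π univ = 1 := by
    have h1 := hπ 1 fun p => by simp
    have h2 : L 1 = 1 := by
      apply le_antisymm
      · simpa using hmaj 1 1 0 fun p => by simp
      · have := hmaj (-1) (-1) 0 fun p => by simp
        simp at this
        linarith
    rw [h2] at h1
    simpa using h1
  have : IsProbabilityMeasure π := ⟨hone⟩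
  refine ⟨π, ?_, ?_, fun u h0 hu => ?_⟩
  · refine map_eq_of_functional L hπ continuous_fst fun φ => le_antisymm ?_ ?_
    · simpa using hmaj (φ.compContinuous ⟨Prod.fst, continuous_fst⟩) φ 0 fun p => by simp
    · have := hmaj (-φ.compContinuous ⟨Prod.fst, continuous_fst⟩) (-φ) 0 fun p => by simp
      simp only [map_neg, BoundedContinuousFunction.coe_neg, Pi.neg_apply, integral_neg,
        BoundedContinuousFunction.coe_zero, Pi.zero_apply, integral_zero] at this
      linarith
  · refine map_eq_of_functional L hπ continuous_snd fun φ => le_antisymm ?_ ?_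
    · simpa using hmaj (φ.compContinuous ⟨Prod.snd, continuous_snd⟩) 0 φ fun p => by simp
    · have := hmaj (-φ.compContinuous ⟨Prod.snd, continuous_snd⟩) 0 (-φ) fun p => by simp
      simp only [map_neg, BoundedContinuousFunction.coe_neg, Pi.neg_apply, integral_neg,
        BoundedContinuousFunction.coe_zero, Pi.zero_apply, integral_zero] at this
      linarith
  · rw [hπ u h0]
    refine ENNReal.ofReal_le_ofReal ?_
    simpa using hL u 0 0 1 ⟨zero_le_one, fun p => by simpa using hu p⟩

end Duality

/-! ### Near-optimal potentials and cyclically monotone supports -/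

section CyclicMonotonicity

open scoped BoundedContinuousFunction

variable {d : ℕ} {C : Set (E d)}

/-- Bounded continuous functions increasing to the cost. -/
noncomputable def costApprox (C : Set (E d)) (k : ℕ) : E d × E d →ᵇ ℝ :=
  BoundedContinuousFunction.ofNormedAddCommGroup
    (fun p => min (k : ℝ) (‖p.2 - p.1‖ ^ 2) + min (k : ℝ) (k * Metric.infDist (p.2 - p.1) C))
    (by
      have : Continuous fun p : E d × E d => Metric.infDist (p.2 - p.1) C :=
        (Metric.continuous_infDist_pt C).comp (by fun_prop)
      fun_prop) (k + k) fun p => by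
      rw [Real.norm_eq_abs, abs_of_nonneg]
      · exact add_le_add (min_le_left _ _) (min_le_left _ _)
      · have := Metric.infDist_nonneg (x := p.2 - p.1) (s := C)
        positivity

lemma costApprox_apply (k : ℕ) (p : E d × E d) : costApprox C k p =
    min (k : ℝ) (‖p.2 - p.1‖ ^ 2) + min (k : ℝ) (k * Metric.infDist (p.2 - p.1) C) := rfl

lemma costApprox_nonneg (k : ℕ) (p : E d × E d) : 0 ≤ costApprox C k p := by
  have := Metric.infDist_nonneg (x := p.2 - p.1) (s := C)
  rw [costApprox_apply]
  positivity

lemma cost_of_mem {x y : E d} (h : y - x ∈ C) : cost C x y = ENNReal.ofReal (‖y - x‖ ^ 2) :=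
  if_pos h

lemma cost_of_notMem {x y : E d} (h : y - x ∉ C) : cost C x y = ⊤ := if_neg h

lemma costApprox_le_cost (k : ℕ) (p : E d × E d) :
    ENNReal.ofReal (costApprox C k p) ≤ cost C p.1 p.2 := by
  by_cases h : p.2 - p.1 ∈ C
  · rw [cost_of_mem h, costApprox_apply, Metric.infDist_zero_of_mem h]
    exact ENNReal.ofReal_le_ofReal (by simp)
  · rw [cost_of_notMem h]
    exact le_top

lemma costApprox_mono (p : E d × E d) : Monotone fun k => costApprox C k p := by
  intro k l h
  have := Metric.infDist_nonneg (x := p.2 - p.1) (s := C)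
  simp only [costApprox_apply]
  gcongr

/-- Off the closed set `C` the distance term is positive and its multiples blow up. Nonemptiness
matters because `Metric.infDist` to `∅` is `0`. -/
lemma tendsto_costApprox (hC : IsClosed C) (hne : C.Nonempty) (p : E d × E d) :
    Tendsto (fun k => ENNReal.ofReal (costApprox C k p)) atTop (𝓝 (cost C p.1 p.2)) := by
  by_cases h : p.2 - p.1 ∈ C
  · rw [cost_of_mem h]
    refine tendsto_const_nhds.congr' ?_
    filter_upwards [eventually_ge_atTop ⌈‖p.2 - p.1‖ ^ 2⌉₊] with k hk
    rw [costApprox_apply, Metric.infDist_zero_of_mem h, min_eq_right (Nat.ceil_le.1 hk)]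
    simp
  · rw [cost_of_notMem h]
    have hpos : 0 < Metric.infDist (p.2 - p.1) C := (hC.notMem_iff_infDist_pos hne).1 h
    refine ENNReal.tendsto_ofReal_nhds_top.2 ?_
    refine tendsto_atTop_mono (f := fun k : ℕ => (k : ℝ) * min 1 (Metric.infDist (p.2 - p.1) C))
      (fun k => ?_) (tendsto_natCast_atTop_atTop.atTop_mul_const (by positivity))
    rw [costApprox_apply, mul_min_of_nonneg _ _ (Nat.cast_nonneg k), mul_one]
    exact le_add_of_nonneg_left (by positivity)

lemma measurable_cost (hC : IsClosed C) : Measurable fun p : E d × E d => cost C p.1 p.2 :=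
  Measurable.ite (hC.measurableSet.preimage (measurable_snd.sub measurable_fst))
    (by fun_prop) measurable_const

variable {f₀ f₁ : Measure (E d)} {γ : Measure (E d × E d)}

lemma exists_plan_totalCost_le [IsProbabilityMeasure f₀] [IsProbabilityMeasure f₁]
    (hC : IsClosed C) (hne : C.Nonempty) {m : ℝ}
    (H : DualBound f₀ f₁ (fun p => cost C p.1 p.2) m) :
    ∃ π, IsPlan f₀ f₁ π ∧ totalCost C π ≤ ENNReal.ofReal m := by
  obtain ⟨π, h0, h1, hπ⟩ := H.exists_plan
  refine ⟨π, ⟨h0, h1⟩, ?_⟩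
  refine le_of_tendsto' (lintegral_tendsto_of_tendsto_of_monotone
    (f := fun k p => ENNReal.ofReal (costApprox C k p))
    (fun k => (ENNReal.continuous_ofReal.comp (costApprox C k).continuous).measurable.aemeasurable)
    (Eventually.of_forall fun p k l hkl => ENNReal.ofReal_le_ofReal (costApprox_mono p hkl))
    (Eventually.of_forall fun p => tendsto_costApprox hC hne p)) fun k => ?_
  exact hπ _ (costApprox_nonneg k) (costApprox_le_cost k)

lemma IsPlan.isProbabilityMeasure [IsProbabilityMeasure f₀] (h : IsPlan f₀ f₁ γ) :
    IsProbabilityMeasure γ := by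
  refine ⟨?_⟩
  have := measure_univ (μ := f₀)
  rwa [← h.1, Measure.map_apply measurable_fst MeasurableSet.univ, preimage_univ] at this

lemma ae_displacement_mem (hC : IsClosed C) (hfin : totalCost C γ < ⊤) :
    ∀ᵐ p ∂γ, p.2 - p.1 ∈ C := by
  filter_upwards [ae_lt_top (measurable_cost hC) hfin.ne] with p hp
  by_contra h
  rw [cost_of_notMem h] at hp
  exact hp.ne rfl

/-- Potentials that are optimal up to `ε` for the dual problem. -/
lemma exists_potentials [IsProbabilityMeasure f₀] [IsProbabilityMeasure f₁]
    (hC : IsClosed C) (hγ : IsOptimalPlan C f₀ f₁ γ)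
    (hfin : totalCost C γ < ⊤) {ε : ℝ} (hε : 0 < ε) :
    ∃ φ ψ : E d →ᵇ ℝ, (∀ x y, y - x ∈ C → φ x + ψ y ≤ ‖y - x‖ ^ 2) ∧
      ∫⁻ p, ENNReal.ofReal (‖p.2 - p.1‖ ^ 2 - φ p.1 - ψ p.2) ∂γ ≤ ENNReal.ofReal ε := by
  have := hγ.1.isProbabilityMeasure
  have hmem := ae_displacement_mem hC hfin
  have hne : C.Nonempty := by
    obtain ⟨p, hp⟩ := hmem.exists
    exact ⟨_, hp⟩
  have hnot : ¬ DualBound f₀ f₁ (fun p => cost C p.1 p.2) ((totalCost C γ).toReal - ε) := by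
    intro H
    obtain ⟨π, hπ, hle⟩ := exists_plan_totalCost_le hC hne H
    -- The zero pair shows that the bound is nonnegative, so `ENNReal.ofReal` does not truncate it.
    have h0 := H 0 0 fun p => by simp
    simp only [BoundedContinuousFunction.coe_zero, Pi.zero_apply, integral_zero, add_zero] at h0
    have h1 := ENNReal.toReal_mono ENNReal.ofReal_ne_top ((hγ.2 π hπ).trans hle)
    rw [ENNReal.toReal_ofReal h0] at h1
    linarith
  simp only [DualBound, not_forall, not_le] at hnot
  obtain ⟨φ, ψ, h, hlt⟩ := hnot
  have hle : ∀ x y, y - x ∈ C → φ x + ψ y ≤ ‖y - x‖ ^ 2 := fun x y hxy => by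
    have := h (x, y)
    rw [cost_of_mem hxy] at this
    exact (ENNReal.ofReal_le_ofReal_iff (by positivity)).1 this
  refine ⟨φ, ψ, hle, ?_⟩
  have hcost : ∫⁻ p, ENNReal.ofReal (‖p.2 - p.1‖ ^ 2) ∂γ = totalCost C γ :=
    lintegral_congr_ae (hmem.mono fun p hp => (cost_of_mem hp).symm)
  have hint : Integrable (fun p : E d × E d => ‖p.2 - p.1‖ ^ 2) γ := by
    refine ⟨by fun_prop, ?_⟩
    rw [hasFiniteIntegral_iff_ofReal (Eventually.of_forall fun p => by positivity), hcost]
    exact hfin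
  have hφ : Integrable (fun p : E d × E d => φ p.1) γ :=
    (φ.compContinuous ⟨Prod.fst, continuous_fst⟩).integrable γ
  have hψ : Integrable (fun p : E d × E d => ψ p.2) γ :=
    (ψ.compContinuous ⟨Prod.snd, continuous_snd⟩).integrable γ
  have hgap : Integrable (fun p : E d × E d => ‖p.2 - p.1‖ ^ 2 - φ p.1 - ψ p.2) γ :=
    (hint.sub hφ).sub hψ
  rw [← ofReal_integral_eq_lintegral_ofReal hgap
    (hmem.mono fun p hp => by
      have := hle _ _ hp
      simp only [Pi.zero_apply]
      linarith)]
  refine ENNReal.ofReal_le_ofReal ?_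
  have e0 : ∫ p, φ p.1 ∂γ = ∫ x, φ x ∂f₀ := by
    rw [← hγ.1.1, integral_map (by fun_prop) (by fun_prop)]
  have e1 : ∫ p, ψ p.2 ∂γ = ∫ x, ψ x ∂f₁ := by
    rw [← hγ.1.2, integral_map (by fun_prop) (by fun_prop)]
  have e2 : ∫ p, ‖p.2 - p.1‖ ^ 2 ∂γ = (totalCost C γ).toReal := by
    rw [← hcost, integral_eq_lintegral_of_nonneg_ae (Eventually.of_forall fun p => by positivity)
      hint.1]
  rw [integral_sub (f := fun p => ‖p.2 - p.1‖ ^ 2 - φ p.1) (hint.sub hφ) hψ,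
    integral_sub hint hφ, e0, e1, e2]
  linarith

/-- A set on which the gaps of a sequence of admissible potentials vanish in the limit is
cyclically monotone. -/
lemma isCyclicallyMonotone_of_potentials (φ ψ : ℕ → E d →ᵇ ℝ)
    (h : ∀ k x y, y - x ∈ C → φ k x + ψ k y ≤ ‖y - x‖ ^ 2) :
    IsCyclicallyMonotone (cost C) {p | p.2 - p.1 ∈ C ∧
      Tendsto (fun k => ENNReal.ofReal (‖p.2 - p.1‖ ^ 2 - φ k p.1 - ψ k p.2)) atTop (𝓝 0)} := by
  intro n p hp σ
  by_cases hσ : ∀ i, (p (σ i)).2 - (p i).1 ∈ C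
  swap
  · push Not at hσ
    obtain ⟨i, hi⟩ := hσ
    exact le_top.trans (ENNReal.sum_eq_top.2 ⟨i, Finset.mem_univ i, cost_of_notMem hi⟩).ge
  simp_rw [fun i => cost_of_mem (hp i).1, fun i => cost_of_mem (hσ i)]
  rw [← ENNReal.ofReal_sum_of_nonneg (fun i _ => by positivity),
    ← ENNReal.ofReal_sum_of_nonneg (fun i _ => by positivity)]
  refine ENNReal.ofReal_le_ofReal ?_
  have hlim : ∀ i, Tendsto (fun k => ‖(p i).2 - (p i).1‖ ^ 2 - φ k (p i).1 - ψ k (p i).2)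
      atTop (𝓝 0) := fun i => by
    have h1 := (ENNReal.tendsto_toReal ENNReal.zero_ne_top).comp (hp i).2
    refine h1.congr fun k => ?_
    rw [Function.comp_apply, ENNReal.toReal_ofReal]
    have := h k _ _ (hp i).1
    linarith
  have hsum := tendsto_finsetSum Finset.univ fun i _ => hlim i
  rw [Finset.sum_const_zero] at hsum
  have hsum' := hsum.const_sub (∑ i, ‖(p i).2 - (p i).1‖ ^ 2)
  rw [sub_zero] at hsum'
  refine le_of_tendsto' hsum' fun k => ?_
  calc ∑ i, ‖(p i).2 - (p i).1‖ ^ 2 -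
        ∑ i, (‖(p i).2 - (p i).1‖ ^ 2 - φ k (p i).1 - ψ k (p i).2)
      = ∑ i, φ k (p i).1 + ∑ i, ψ k (p i).2 := by
        simp only [Finset.sum_sub_distrib]
        ring
    -- The sum of the `ψ` terms does not see the permutation of the targets.
    _ = ∑ i, φ k (p i).1 + ∑ i, ψ k (p (σ i)).2 := by
        rw [Equiv.sum_comp σ fun i => ψ k (p i).2]
    _ = ∑ i, (φ k (p i).1 + ψ k (p (σ i)).2) := Finset.sum_add_distrib.symm
    _ ≤ ∑ i, ‖(p (σ i)).2 - (p i).1‖ ^ 2 := Finset.sum_le_sum fun i _ => h k _ _ (hσ i)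

lemma IsCyclicallyMonotone.mono {c : E d → E d → ℝ≥0∞} {Γ Γ' : Set (E d × E d)}
    (h : IsCyclicallyMonotone c Γ) (hs : Γ' ⊆ Γ) : IsCyclicallyMonotone c Γ' :=
  fun n p hp σ => h n p (fun i => hs (hp i)) σ

/-- A property that holds almost everywhere holds on a σ-compact set of full measure. -/
lemma exists_isSigmaCompact_of_ae {X : Type*} [TopologicalSpace X] [MeasurableSpace X]
    [OpensMeasurableSpace X] [T2Space X] {μ : Measure X} [IsFiniteMeasure μ]
    [μ.InnerRegularCompactLTTop] {P : X → Prop} (h : ∀ᵐ x ∂μ, P x) :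
    ∃ K, IsSigmaCompact K ∧ μ Kᶜ = 0 ∧ ∀ x ∈ K, P x := by
  have hm : MeasurableSet (toMeasurable μ {x | ¬ P x})ᶜ := (measurableSet_toMeasurable _ _).compl
  have hK : ∀ n : ℕ, ∃ K ⊆ (toMeasurable μ {x | ¬ P x})ᶜ, IsCompact K ∧
      μ ((toMeasurable μ {x | ¬ P x})ᶜ \ K) < ((n : ℝ≥0∞) + 1)⁻¹ := fun n =>
    hm.exists_isCompact_sdiff_lt (measure_ne_top _ _) (by simp)
  choose K hsub hcomp hlt using hK
  refine ⟨⋃ n, K n, isSigmaCompact_iUnion_of_isCompact K hcomp, ?_, fun x hx => ?_⟩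
  · have h0 : μ ((toMeasurable μ {x | ¬ P x})ᶜ \ ⋃ n, K n) = 0 := by
      have ht : Tendsto (fun n : ℕ => ((n : ℝ≥0∞) + 1)⁻¹) atTop (𝓝 0) := by
        have := (tendsto_add_atTop_iff_nat 1).2 ENNReal.tendsto_inv_nat_nhds_zero
        simpa using this
      exact le_antisymm (ge_of_tendsto' ht fun n =>
        (measure_mono (sdiff_subset_sdiff_right (subset_iUnion K n))).trans (hlt n).le) zero_le
    refine measure_mono_null (t := toMeasurable μ {x | ¬ P x} ∪
      ((toMeasurable μ {x | ¬ P x})ᶜ \ ⋃ n, K n)) (fun x hx => ?_)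
      (measure_union_null ((measure_toMeasurable _).trans h) h0)
    by_cases hx' : x ∈ toMeasurable μ {x | ¬ P x}
    · exact Or.inl hx'
    · exact Or.inr ⟨hx', hx⟩
  · obtain ⟨n, hn⟩ := mem_iUnion.1 hx
    by_contra hP
    exact hsub n hn (subset_toMeasurable _ _ hP)

/-- An optimal plan with finite cost is concentrated on a σ-compact cyclically monotone set. -/
theorem IsOptimalPlan.exists_isMonotoneSupport [IsProbabilityMeasure f₀] [IsProbabilityMeasure f₁]
    (hC : IsClosed C) (hγ : IsOptimalPlan C f₀ f₁ γ) (hfin : totalCost C γ < ⊤) :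
    ∃ Γ, IsMonotoneSupport C γ Γ := by
  have := hγ.1.isProbabilityMeasure
  -- Summable gaps have an almost everywhere finite sum, hence tend to zero without passing to a
  -- subsequence.
  choose φ ψ hle hint using fun k : ℕ =>
    exists_potentials hC hγ hfin (ε := (1 / 2 : ℝ) ^ k) (by positivity)
  have hmeas : ∀ k, Measurable fun p : E d × E d =>
      ENNReal.ofReal (‖p.2 - p.1‖ ^ 2 - φ k p.1 - ψ k p.2) := fun k =>
    (ENNReal.continuous_ofReal.comp (by fun_prop)).measurable
  have hsum : ∑' k, ∫⁻ p, ENNReal.ofReal (‖p.2 - p.1‖ ^ 2 - φ k p.1 - ψ k p.2) ∂γ ≠ ⊤ := by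
    refine ne_top_of_le_ne_top ?_ (ENNReal.tsum_le_tsum hint)
    rw [← ENNReal.ofReal_tsum_of_nonneg (fun k => by positivity) summable_geometric_two]
    exact ENNReal.ofReal_ne_top
  rw [← lintegral_tsum fun k => (hmeas k).aemeasurable] at hsum
  have hae : ∀ᵐ p ∂γ, p.2 - p.1 ∈ C ∧
      Tendsto (fun k => ENNReal.ofReal (‖p.2 - p.1‖ ^ 2 - φ k p.1 - ψ k p.2)) atTop (𝓝 0) := by
    filter_upwards [ae_displacement_mem hC hfin,
      ae_lt_top (Measurable.tsum hmeas) hsum] with p h1 h2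
    exact ⟨h1, ENNReal.tendsto_atTop_zero_of_tsum_ne_top h2.ne⟩
  obtain ⟨Γ, hs, h0, hΓ⟩ := exists_isSigmaCompact_of_ae hae
  exact ⟨Γ, hs, h0, fun p hp => (hΓ p hp).1,
    (isCyclicallyMonotone_of_potentials φ ψ hle).mono hΓ⟩

end CyclicMonotonicity

/-! ### Recurrence and density points -/

section Density

variable {d : ℕ}

/-- Almost every point of a measurable set returns to the set by arbitrarily small positive
multiples of a given vector. -/
lemma ae_exists_small_translate_mem {A : Set (E d)} (hA : MeasurableSet A) (w : E d) :
    ∀ᵐ x, x ∈ A → ∀ δ : ℝ, 0 < δ → ∃ ε : ℝ, 0 < ε ∧ ε < δ ∧ x + ε • w ∈ A := by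
  -- The points of `A` with no return at scale `n` have pairwise disjoint translates by the bounded
  -- sequence `w / (n + k + 1)`, so they form a null set.
  have key : ∀ n : ℕ, volume (A ∩ ⋂ k : ℕ, ⋂ l : ℕ, {x | n ≤ k → k < l →
      x + ((1 : ℝ) / (k + 1) - 1 / (l + 1)) • w ∉ A}) = 0 := by
    intro n
    refine Measure.addHaar_eq_zero_of_disjoint_translates volume
      (fun k : ℕ => ((1 : ℝ) / ((n + k : ℕ) + 1)) • w) ?_ ?_ ?_
    · refine (Metric.isBounded_closedBall (x := (0 : E d)) (r := ‖w‖)).subset ?_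
      rintro _ ⟨k, rfl⟩
      rw [mem_closedBall_zero_iff, norm_smul, Real.norm_of_nonneg (by positivity)]
      refine mul_le_of_le_one_left (norm_nonneg w) ?_
      rw [div_le_one (by positivity)]
      linarith [Nat.cast_nonneg (α := ℝ) (n + k)]
    · have aux : ∀ k l : ℕ, k < l → ∀ x ∈ (A ∩ ⋂ k : ℕ, ⋂ l : ℕ, {x | n ≤ k → k < l →
          x + ((1 : ℝ) / (k + 1) - 1 / (l + 1)) • w ∉ A}), ∀ y ∈ A,
          ((1 : ℝ) / ((n + k : ℕ) + 1)) • w + x ≠ ((1 : ℝ) / ((n + l : ℕ) + 1)) • w + y := by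
        intro k l hkl x hx y hy h
        have h1 := mem_iInter.1 (mem_iInter.1 hx.2 (n + k)) (n + l) (by omega) (by omega)
        refine h1 ?_
        rw [sub_smul, ← add_sub_assoc, add_comm x, h, add_sub_cancel_left]
        exact hy
      intro k l hkl
      simp only [Function.onFun, singleton_add, disjoint_left]
      rintro _ ⟨x, hx, rfl⟩ ⟨y, hy, hxy⟩
      rcases lt_or_gt_of_ne hkl with h | h
      · exact aux k l h x hx y hy.1 hxy.symm
      · exact aux l k h y hy x hx.1 hxy
    · refine hA.inter (MeasurableSet.iInter fun k => MeasurableSet.iInter fun l => ?_)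
      by_cases h : n ≤ k ∧ k < l
      · simp only [h.1, h.2, true_imp_iff]
        exact (hA.preimage (measurable_id.add_const _)).compl
      · convert MeasurableSet.univ
        rw [eq_univ_iff_forall]
        exact fun x h1 h2 => absurd ⟨h1, h2⟩ h
  filter_upwards [ae_all_iff.2 fun n => measure_eq_zero_iff_ae_notMem.1 (key n)] with x hx hxA δ hδ
  obtain ⟨n, hn⟩ := exists_nat_one_div_lt hδ
  have h1 := hx n
  simp only [mem_inter_iff, hxA, true_and, mem_iInter, mem_ofPred_eq, not_forall, not_not] at h1
  obtain ⟨k, l, hk, hl, h⟩ := h1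
  refine ⟨_, ?_, ?_, h⟩
  · rw [sub_pos]
    apply one_div_lt_one_div_of_lt
    · positivity
    · exact_mod_cast Nat.add_lt_add_right hl 1
  · have h2 : (1 : ℝ) / (k + 1) ≤ 1 / (n + 1) := by gcongr
    have h3 : (0 : ℝ) < 1 / (l + 1) := by positivity
    linarith

/-- Almost every point of a set is a Lebesgue point. -/
lemma ae_isLebesguePoint {A : Set (E d)} (hA : MeasurableSet A) :
    ∀ᵐ x, x ∈ A → IsLebesguePoint A x := by
  filter_upwards [Besicovitch.ae_tendsto_measure_inter_div_of_measurableSet volume hA] with x hx hxA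
  rw [indicator_of_mem hxA, Pi.one_apply] at hx
  refine hx.congr' ?_
  filter_upwards [self_mem_nhdsWithin] with r hr
  -- The Besicovitch theorem concerns closed balls; spheres of nonzero radius are null.
  have hae : (Metric.ball x r : Set (E d)) =ᵐ[volume] Metric.closedBall x r := by
    rw [← Metric.ball_union_sphere]
    exact (union_ae_eq_left_of_ae_eq_empty
      (ae_eq_empty.2 (Measure.addHaar_sphere_of_ne_zero volume x (ne_of_gt hr)))).symm
  rw [measure_congr hae, measure_congr ((ae_eq_refl A).inter hae)]

lemma IsLebesguePoint.mono {A B : Set (E d)} {x : E d} (h : IsLebesguePoint A x) (hAB : A ⊆ B) :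
    IsLebesguePoint B x := by
  refine tendsto_of_tendsto_of_tendsto_of_le_of_le h tendsto_const_nhds
    (fun r => ENNReal.div_le_div_right (measure_mono (inter_subset_inter_left _ hAB)) _)
    fun r => ?_
  exact ENNReal.div_le_of_le_mul (by rw [one_mul]; exact measure_mono inter_subset_right)

variable {f₀ f₁ : Measure (E d)} {γ : Measure (E d × E d)} {Γ : Set (E d × E d)}

/-- Here σ-compactness pays off: the projection is a countable union of compact sets. -/
lemma measurableSet_preimageOf (hΓ : IsSigmaCompact Γ) {B : Set (E d)} (hB : IsClosed B) :
    MeasurableSet (preimageOf Γ B) := by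
  obtain ⟨K, hK, rfl⟩ := hΓ
  have : preimageOf (⋃ n, K n) B = ⋃ n, Prod.fst '' (K n ∩ (univ ×ˢ B)) := by
    rw [preimageOf, iUnion_inter, image_iUnion]
  rw [this]
  exact MeasurableSet.iUnion fun n =>
    (((hK n).inter_right (isClosed_univ.prod hB)).image continuous_fst).measurableSet

lemma preimageOf_mono {B B' : Set (E d)} (h : B ⊆ B') : preimageOf Γ B ⊆ preimageOf Γ B' :=
  image_mono (inter_subset_inter_right _ (prod_mono_right h))

/-- If almost every point of each measurable set `A` satisfies the monotone property `P A`, then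
`γ`-almost all points `(x, y)` of `Γ` satisfy `P (Γ⁻¹(B)) x` for all closed balls `B` at `y`. -/
lemma ae_forall_preimageOf_closedBall (hf₀ : f₀ ≪ volume) (hγ : γ.map Prod.fst = f₀)
    (hΓ : IsSigmaCompact Γ) (hΓγ : γ Γᶜ = 0) {P : Set (E d) → E d → Prop}
    (hP : ∀ A, MeasurableSet A → ∀ᵐ x, x ∈ A → P A x)
    (hmono : ∀ A B x, A ⊆ B → P A x → P B x) :
    ∀ᵐ p ∂γ, ∀ r : ℝ, 0 < r → P (preimageOf Γ (Metric.closedBall p.2 r)) p.1 := by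
  -- Countably many balls suffice: one of radius less than `r / 2` that contains `p.2` lies inside
  -- the closed ball of radius `r` at `p.2`.
  have hae : ∀ᵐ p ∂γ, ∀ n k : ℕ,
      p.1 ∈ preimageOf Γ (Metric.closedBall (TopologicalSpace.denseSeq (E d) n) (1 / (k + 1))) →
      P (preimageOf Γ (Metric.closedBall (TopologicalSpace.denseSeq (E d) n) (1 / (k + 1)))) p.1 :=
    ae_all_iff.2 fun n => ae_all_iff.2 fun k => by
      have h1 := hf₀.ae_le
        (hP _ (measurableSet_preimageOf hΓ (Metric.isClosed_closedBall
          (x := TopologicalSpace.denseSeq (E d) n) (ε := 1 / (k + 1)))))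
      rw [← hγ] at h1
      exact ae_of_ae_map measurable_fst.aemeasurable h1
  filter_upwards [hae, measure_eq_zero_iff_ae_notMem.1 hΓγ] with p hp hpΓ r hr
  obtain ⟨k, hk⟩ := exists_nat_one_div_lt (half_pos hr)
  obtain ⟨n, hn⟩ := (TopologicalSpace.denseRange_denseSeq (E d)).exists_dist_lt p.2
    (show (0 : ℝ) < 1 / (k + 1) by positivity)
  refine hmono _ _ _ (preimageOf_mono ?_) (hp n k ⟨p, ⟨not_not.1 hpΓ, mem_univ _, hn.le⟩, rfl⟩)
  exact Metric.closedBall_subset_closedBall' (by rw [dist_comm]; linarith)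

end Density

/-! ### Segments between displacements and flat parts -/

section FlatParts

variable {d : ℕ} {C : Set (E d)}

lemma exists_ball_of_mem_intrinsicInterior {s : E d} (hs : s ∈ intrinsicInterior ℝ C) :
    ∃ ρ > 0, ∀ u ∈ (affineSpan ℝ C).direction, ‖u‖ < ρ → s + u ∈ C := by
  obtain ⟨y, hy, rfl⟩ := mem_intrinsicInterior.1 hs
  obtain ⟨ρ, hρ, hball⟩ := Metric.mem_nhds_iff.1 (mem_interior_iff_mem_nhds.1 hy)
  refine ⟨ρ, hρ, fun u hu hlt => ?_⟩
  have hmem : (y : E d) + u ∈ affineSpan ℝ C := by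
    have := AffineSubspace.vadd_mem_of_mem_direction hu y.2
    rwa [vadd_eq_add, add_comm] at this
  have : (⟨(y : E d) + u, hmem⟩ : affineSpan ℝ C) ∈ Metric.ball y ρ := by
    rw [Metric.mem_ball, Subtype.dist_eq, dist_eq_norm]
    simpa using hlt
  exact hball this

/-- The homothety of centre `q` and ratio `1 / (2(1 - t)) ≤ 1` preserves `C` and sends the given
point to the midpoint; the radius shrinks at most by half. -/
lemma exists_ball_midpoint_of_lineMap (hC : Convex ℝ C) {p q : E d} (hq : q ∈ C)
    {t : ℝ} (ht : t ≤ 1 / 2) (h0 : 0 ≤ t) {ρ : ℝ} (hρ : 0 < ρ)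
    (h : ∀ u ∈ (affineSpan ℝ C).direction, ‖u‖ < ρ → (1 - t) • p + t • q + u ∈ C) :
    ∃ ρ' > 0, ∀ u ∈ (affineSpan ℝ C).direction, ‖u‖ < ρ' →
      (1 / 2 : ℝ) • p + (1 / 2 : ℝ) • q + u ∈ C := by
  refine ⟨ρ / 2, half_pos hρ, fun u hu hlt => ?_⟩
  have ht' : 0 < 1 - t := by linarith
  have h1 := h ((2 * (1 - t)) • u) (Submodule.smul_mem _ _ hu) (by
    rw [norm_smul, Real.norm_of_nonneg (by positivity)]
    nlinarith [norm_nonneg u])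
  have h2 := hC h1 hq (a := 1 / (2 * (1 - t))) (b := 1 - 1 / (2 * (1 - t))) (by positivity)
    (by
      rw [sub_nonneg, div_le_one (by positivity)]
      linarith) (by ring)
  convert h2 using 1
  match_scalars <;> field_simp
  ring

lemma exists_ball_midpoint (hC : Convex ℝ C) {p q s : E d} (hp : p ∈ C) (hq : q ∈ C)
    (hs : s ∈ segment ℝ p q) (hint : s ∈ intrinsicInterior ℝ C) :
    ∃ ρ > 0, ∀ u ∈ (affineSpan ℝ C).direction, ‖u‖ < ρ →
      (1 / 2 : ℝ) • p + (1 / 2 : ℝ) • q + u ∈ C := by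
  obtain ⟨ρ, hρ, h⟩ := exists_ball_of_mem_intrinsicInterior hint
  obtain ⟨a, b, ha, hb, hab, rfl⟩ := hs
  rcases le_total b (1 / 2) with hb2 | hb2
  · refine exists_ball_midpoint_of_lineMap hC hq hb2 hb hρ ?_
    rwa [← hab, add_sub_cancel_right]
  · rw [add_comm (a • p)] at h
    rw [add_comm ((1 / 2 : ℝ) • p)]
    refine exists_ball_midpoint_of_lineMap hC hp (t := a) (by linarith) ha hρ ?_
    rwa [← hab, add_sub_cancel_left]

lemma IsStraightPart.exists_isMaximalFlatPart {S : Set (E d)} (hS : IsStraightPart S C) :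
    ∃ F, S ⊆ F ∧ IsMaximalFlatPart F C := by
  refine zorn_subset_nonempty {S | IsStraightPart S C} (fun c hc hchain hne =>
    ⟨⋃₀ c, ⟨?_, ?_, ?_, ?_⟩, fun s hs => subset_sUnion_of_mem hs⟩) S hS
  · exact hchain.directedOn.convex_sUnion fun s hs => (hc hs).1
  · obtain ⟨s, hs⟩ := hne
    exact (hc hs).2.1.mono (subset_sUnion_of_mem hs)
  · exact sUnion_subset fun s hs => (hc hs).2.2.1
  · exact sUnion_subset fun s hs => (hc hs).2.2.2

/-- Swapping the targets of two points of a monotone set whose displacements stay in `C` does not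
decrease the cost. -/
lemma inner_nonpos_of_isCyclicallyMonotone {Γ : Set (E d × E d)}
    (hΓ : IsCyclicallyMonotone (cost C) Γ) {a b w x : E d}
    (ha : (x + w, x + w + a) ∈ Γ) (hb : (x, x + b) ∈ Γ) (haC : a ∈ C) (hbC : b ∈ C)
    (haw : a + w ∈ C) (hbw : b - w ∈ C) : inner ℝ w (b - w - a) ≤ 0 := by
  have h := hΓ 2 ![(x + w, x + w + a), (x, x + b)]
    (by intro i; fin_cases i <;> simpa) (Equiv.swap 0 1)
  simp only [Fin.sum_univ_two, Equiv.swap_apply_left, Equiv.swap_apply_right,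
    Matrix.cons_val_zero, Matrix.cons_val_one] at h
  have e1 : x + w + a - (x + w) = a := by abel
  have e2 : x + b - x = b := by abel
  have e3 : x + b - (x + w) = b - w := by abel
  have e4 : x + w + a - x = a + w := by abel
  rw [cost_of_mem (by rwa [e1]), cost_of_mem (by rwa [e2]), cost_of_mem (by rwa [e3]),
    cost_of_mem (by rwa [e4]), e1, e2, e3, e4, ← ENNReal.ofReal_add (by positivity) (by positivity),
    ← ENNReal.ofReal_add (by positivity) (by positivity),
    ENNReal.ofReal_le_ofReal_iff (by positivity), norm_sub_sq_real, norm_add_sq_real] at h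
  rw [inner_sub_right, inner_sub_right, real_inner_self_eq_norm_sq, real_inner_comm b w,
    real_inner_comm a w]
  linarith

/-- Two displacements at the same point, one of which is attained (approximately) also at nearby
points in a dense set of directions, have a midpoint outside of the relative interior of `C`. -/
lemma false_of_ball_midpoint (hC : Convex ℝ C) {Γ : Set (E d × E d)}
    (hΓ : IsCyclicallyMonotone (cost C) Γ) (hΓC : ∀ p ∈ Γ, p.2 - p.1 ∈ C)
    {S : Set (E d)} (hSdir : S ⊆ (affineSpan ℝ C).direction)
    (hS : ((affineSpan ℝ C).direction : Set (E d)) ⊆ closure S)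
    {x₀ p q : E d} (hp : p ∈ C) (hq : (x₀, x₀ + q) ∈ Γ) (hpq : p ≠ q)
    (hdense : ∀ w ∈ S, ∀ r : ℝ, 0 < r → ∀ δ : ℝ, 0 < δ → ∃ ε, 0 < ε ∧ ε < δ ∧
      x₀ + ε • w ∈ preimageOf Γ (Metric.closedBall (x₀ + p) r))
    {ρ : ℝ} (hρ : 0 < ρ)
    (hball : ∀ u ∈ (affineSpan ℝ C).direction, ‖u‖ < ρ →
      (1 / 2 : ℝ) • p + (1 / 2 : ℝ) • q + u ∈ C) : False := by
  have hdir : ∀ a ∈ C, ∀ b ∈ C, a - b ∈ (affineSpan ℝ C).direction := fun a ha b hb =>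
    AffineSubspace.vsub_mem_direction (subset_affineSpan ℝ C ha) (subset_affineSpan ℝ C hb)
  have hqC : q ∈ C := by simpa using hΓC _ hq
  have hv : 0 < ‖q - p‖ := norm_pos_iff.2 (sub_ne_zero.2 hpq.symm)
  -- The bound by `ρ` keeps the swapped displacements in `C`; the bound by `‖q - p‖` makes the final
  -- inner product positive.
  set η : ℝ := min ρ ‖q - p‖ / 4 with hη
  have hη0 : 0 < η := by positivity
  have hη1 : η ≤ ρ / 4 := div_le_div_of_nonneg_right (min_le_left _ _) (by norm_num)
  have hη2 : η ≤ ‖q - p‖ / 4 := div_le_div_of_nonneg_right (min_le_right _ _) (by norm_num)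
  obtain ⟨w, hw, hwv⟩ := Metric.mem_closure_iff.1 (hS (hdir q hqC p hp)) η hη0
  rw [dist_eq_norm, norm_sub_rev] at hwv
  obtain ⟨ε, hε0, hε, ⟨x, y⟩, ⟨hxy, -, hy⟩, hx⟩ := hdense w hw η hη0
    (min (1 / 2) (ρ / (4 * (‖w‖ + 1)))) (by positivity)
  obtain rfl : x = x₀ + ε • w := hx
  have hε2 : 2 * ε ≤ 1 := by linarith [hε.trans_le (min_le_left _ _)]
  have hεw : ε * ‖w‖ ≤ ρ / 4 := by
    have h1 := (hε.trans_le (min_le_right _ _)).le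
    rw [le_div_iff₀ (by positivity)] at h1
    nlinarith
  obtain ⟨a, rfl⟩ : ∃ a, y = x₀ + ε • w + a := ⟨y - (x₀ + ε • w), by abel⟩
  have haC : a ∈ C := by simpa using hΓC _ hxy
  replace hy : ‖ε • w + a - p‖ ≤ η := by
    have : x₀ + ε • w + a - (x₀ + p) = ε • w + a - p := by abel
    rwa [Metric.mem_closedBall, dist_eq_norm, this] at hy
  -- A convex combination of `q`, with weight `1 - 2ε`, and a point near the midpoint, with weight
  -- `2ε`; likewise for `a + ε • w`.
  have h1 : q - ε • w ∈ C := by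
    have h2 := hball ((1 / 2 : ℝ) • (q - p - w))
      (Submodule.smul_mem _ _ (Submodule.sub_mem _ (hdir q hqC p hp) (hSdir hw))) (by
        rw [norm_smul, norm_sub_rev (q - p), Real.norm_of_nonneg (by norm_num)]
        linarith)
    have h3 := hC hqC h2 (a := 1 - 2 * ε) (b := 2 * ε) (by linarith) (by linarith) (by ring)
    convert h3 using 1
    match_scalars <;> ring
  have h2 : a + ε • w ∈ C := by
    have h2 := hball ((a - p) + (1 / 2 : ℝ) • (w - (q - p)))
      (Submodule.add_mem _ (hdir a haC p hp) (Submodule.smul_mem _ _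
        (Submodule.sub_mem _ (hSdir hw) (hdir q hqC p hp)))) (by
        have e : a - p = (ε • w + a - p) - ε • w := by abel
        have n1 : ‖a - p‖ ≤ η + ε * ‖w‖ := by
          rw [e]
          refine (norm_sub_le _ _).trans (add_le_add hy ?_)
          rw [norm_smul, Real.norm_of_nonneg hε0.le]
        have n2 : ‖(1 / 2 : ℝ) • (w - (q - p))‖ ≤ η := by
          rw [norm_smul, Real.norm_of_nonneg (by norm_num)]
          linarith
        linarith [norm_add_le (a - p) ((1 / 2 : ℝ) • (w - (q - p)))])
    have h3 := hC haC h2 (a := 1 - 2 * ε) (b := 2 * ε) (by linarith) (by linarith) (by ring)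
    convert h3 using 1
    match_scalars <;> ring
  have h3 := inner_nonpos_of_isCyclicallyMonotone hΓ hxy hq haC hqC h2 h1
  rw [real_inner_smul_left] at h3
  replace h3 : inner ℝ w (q - ε • w - a) ≤ 0 := by
    by_contra! h
    linarith [mul_pos hε0 h]
  have e : inner ℝ w (q - ε • w - a) = inner ℝ (q - p) (q - p)
      - inner ℝ (q - p) (ε • w + a - p) + inner ℝ (w - (q - p)) (q - p)
      - inner ℝ (w - (q - p)) (ε • w + a - p) := by
    have : q - ε • w - a = (q - p) - (ε • w + a - p) := by abel
    rw [this]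
    simp only [inner_sub_left, inner_sub_right]
    ring
  rw [e, real_inner_self_eq_norm_sq] at h3
  have i1 := (le_abs_self _).trans (abs_real_inner_le_norm (q - p) (ε • w + a - p))
  have i2 := (neg_le_abs _).trans (abs_real_inner_le_norm (w - (q - p)) (q - p))
  have i3 := (le_abs_self _).trans (abs_real_inner_le_norm (w - (q - p)) (ε • w + a - p))
  have j1 : ‖q - p‖ * ‖ε • w + a - p‖ ≤ ‖q - p‖ * (‖q - p‖ / 4) :=
    mul_le_mul_of_nonneg_left (hy.trans hη2) hv.le
  have j2 : ‖w - (q - p)‖ * ‖q - p‖ ≤ (‖q - p‖ / 4) * ‖q - p‖ :=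
    mul_le_mul_of_nonneg_right (hwv.le.trans hη2) hv.le
  have j3 : ‖w - (q - p)‖ * ‖ε • w + a - p‖ ≤ (‖q - p‖ / 4) * (‖q - p‖ / 4) :=
    mul_le_mul (hwv.le.trans hη2) (hy.trans hη2) (norm_nonneg _) (by positivity)
  -- The inner product is at least `(1 - 1/4 - 1/4 - 1/16)‖q - p‖² > 0`.
  nlinarith [mul_pos hv hv]

/-- Under the same assumptions, the two displacements lie in a common flat part. -/
lemma exists_isFlatPart (hC : Convex ℝ C) {Γ : Set (E d × E d)}
    (hΓ : IsCyclicallyMonotone (cost C) Γ) (hΓC : ∀ p ∈ Γ, p.2 - p.1 ∈ C)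
    {S : Set (E d)} (hSdir : S ⊆ (affineSpan ℝ C).direction)
    (hS : ((affineSpan ℝ C).direction : Set (E d)) ⊆ closure S)
    {x₀ y₀ y₀' : E d} (h : (x₀, y₀) ∈ Γ) (h' : (x₀, y₀') ∈ Γ) (hne : y₀ ≠ y₀')
    (hdense : ∀ w ∈ S, ∀ r : ℝ, 0 < r → ∀ δ : ℝ, 0 < δ → ∃ ε, 0 < ε ∧ ε < δ ∧
      x₀ + ε • w ∈ preimageOf Γ (Metric.closedBall y₀ r)) :
    ∃ F, IsFlatPart F C ∧ y₀ - x₀ ∈ F ∧ y₀' - x₀ ∈ F := by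
  have hp : y₀ - x₀ ∈ C := hΓC _ h
  have hq : y₀' - x₀ ∈ C := hΓC _ h'
  have hpq : y₀ - x₀ ≠ y₀' - x₀ := fun e => hne (sub_left_injective e)
  have hsub : segment ℝ (y₀ - x₀) (y₀' - x₀) ⊆ C := hC.segment_subset hp hq
  have hstraight : IsStraightPart (segment ℝ (y₀ - x₀) (y₀' - x₀)) C := by
    refine ⟨convex_segment _ _, ⟨_, left_mem_segment ℝ _ _, _, right_mem_segment ℝ _ _, hpq⟩, hsub,
      fun s hs => ?_⟩
    have hs' := subset_intrinsicClosure (𝕜 := ℝ) (hsub hs)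
    rw [← intrinsicInterior_union_intrinsicFrontier] at hs'
    refine hs'.resolve_left fun hint => ?_
    obtain ⟨ρ, hρ, hball⟩ := exists_ball_midpoint hC hp hq hs hint
    exact false_of_ball_midpoint hC hΓ hΓC hSdir hS hp (x₀ := x₀) (by simpa using h') hpq
      (by simpa using hdense) hρ hball
  obtain ⟨F, hF, hmax⟩ := hstraight.exists_isMaximalFlatPart
  exact ⟨F, Relation.TransGen.single hmax, hF (left_mem_segment ℝ _ _),
    hF (right_mem_segment ℝ _ _)⟩

end FlatParts

/-! ### Single-valued fibres, Lebesgue supports and conclusion -/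

section Graph

variable {d : ℕ}

/-- A plan concentrated on a σ-compact set with single-valued fibres is induced by a Borel map. -/
lemma isConcentratedOnGraph_of_fiber_unique {f₀ : Measure (E d)} {γ : Measure (E d × E d)}
    (hγ : γ.map Prod.fst = f₀) {R : Set (E d × E d)} (hR : IsSigmaCompact R) (hRγ : γ Rᶜ = 0)
    (huniq : ∀ x y y', (x, y) ∈ R → (x, y') ∈ R → y = y') : IsConcentratedOnGraph f₀ γ := by
  classical
  have hinj : InjOn Prod.fst R := by
    rintro ⟨x, y⟩ h ⟨x', y'⟩ h' (rfl : x = x')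
    rw [huniq x y y' h h']
  have hRm : MeasurableSet R := by
    obtain ⟨K, hK, rfl⟩ := hR
    exact MeasurableSet.iUnion fun n => (hK n).measurableSet
  -- Lusin–Souslin: an injective measurable image of a Borel set is Borel.
  have himage : ∀ B, MeasurableSet B → MeasurableSet (Prod.fst '' (R ∩ Prod.snd ⁻¹' B)) :=
    fun B hB => (hRm.inter (measurable_snd hB)).image_of_measurable_injOn measurable_fst
      (hinj.mono inter_subset_left)
  let T : E d → E d := fun x => if h : ∃ y, (x, y) ∈ R then h.choose else 0
  have hT : ∀ x y, (x, y) ∈ R → T x = y := fun x y hxy => by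
    have h : ∃ y, (x, y) ∈ R := ⟨y, hxy⟩
    simp only [T, dif_pos h]
    exact huniq _ _ _ h.choose_spec hxy
  have hT0 : ∀ x, (¬ ∃ y, (x, y) ∈ R) → T x = 0 := fun x h => dif_neg h
  have hTm : Measurable T := by
    intro B hB
    have e : T ⁻¹' B = Prod.fst '' (R ∩ Prod.snd ⁻¹' B) ∪
        ((Prod.fst '' (R ∩ Prod.snd ⁻¹' univ))ᶜ ∩ {_x | (0 : E d) ∈ B}) := by
      ext x
      by_cases h : ∃ y, (x, y) ∈ R
      · obtain ⟨y, hy⟩ := h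
        simp only [mem_preimage, hT x y hy, mem_union, mem_image, mem_inter_iff, preimage_univ,
          Prod.exists, mem_univ, and_true, exists_and_right, exists_eq_right, mem_compl_iff]
        constructor
        · exact fun hyB => Or.inl ⟨y, hy, hyB⟩
        · rintro (⟨y', hy', hB'⟩ | ⟨hn, -⟩)
          · rwa [huniq x y y' hy hy']
          · exact absurd ⟨y, hy⟩ hn
      · simp only [mem_preimage, hT0 x h, mem_union, mem_image, mem_inter_iff, preimage_univ,
          Prod.exists, mem_univ, and_true, exists_and_right, exists_eq_right, mem_compl_iff]
        constructor
        · exact fun hB' => Or.inr ⟨h, hB'⟩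
        · rintro (⟨y', hy', -⟩ | ⟨-, hB'⟩)
          · exact absurd ⟨y', hy'⟩ h
          · exact hB'
    rw [e]
    exact (himage B hB).union ((himage univ MeasurableSet.univ).compl.inter (.const _))
  have hae : ∀ᵐ p ∂γ, p.2 = T p.1 := by
    filter_upwards [measure_eq_zero_iff_ae_notMem.1 hRγ] with p hp
    exact (hT p.1 p.2 (not_not.1 hp)).symm
  refine ⟨T, hTm, hae, ?_⟩
  rw [← hγ, Measure.map_map (by fun_prop) measurable_fst]
  nth_rewrite 1 [← Measure.map_id (μ := γ)]
  exact Measure.map_congr (hae.mono fun p hp => Prod.ext rfl hp)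

/-- A monotone support of a plan contains a σ-compact set of full measure consisting of Lebesgue
points, over which distinct displacements at the same point lie in a common flat part. -/
theorem IsMonotoneSupport.exists_isLebesgueSupport {C : Set (E d)} (hC : Convex ℝ C)
    {f₀ : Measure (E d)} {γ : Measure (E d × E d)} [IsFiniteMeasure γ]
    (hf₀ : f₀ ≪ volume) (hγ : γ.map Prod.fst = f₀) {Γ : Set (E d × E d)}
    (hΓ : IsMonotoneSupport C γ Γ) :
    ∃ R, IsLebesgueSupport γ Γ R ∧ ∀ x₀ y₀ y₀', (x₀, y₀) ∈ R → (x₀, y₀') ∈ R → y₀ ≠ y₀' →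
      ∃ F, IsFlatPart F C ∧ y₀ - x₀ ∈ F ∧ y₀' - x₀ ∈ F := by
  -- The exceptional null set depends on the direction, so only countably many are allowed.
  obtain ⟨S, hSsub, hScount, hSdense⟩ := (TopologicalSpace.IsSeparable.of_separableSpace
    ((affineSpan ℝ C).direction : Set (E d))).exists_countable_dense_subset
  have hleb := ae_forall_preimageOf_closedBall hf₀ hγ hΓ.sigmaCompact hΓ.concentrated
    (P := IsLebesguePoint) (fun A hA => ae_isLebesguePoint hA) fun A B x h hA => hA.mono h
  have hret := fun w => ae_forall_preimageOf_closedBall hf₀ hγ hΓ.sigmaCompact hΓ.concentrated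
    (P := fun A x => ∀ δ : ℝ, 0 < δ → ∃ ε : ℝ, 0 < ε ∧ ε < δ ∧ x + ε • w ∈ A)
    (fun A hA => ae_exists_small_translate_mem hA w) fun A B x h hA δ hδ => by
      obtain ⟨ε, h1, h2, h3⟩ := hA δ hδ
      exact ⟨ε, h1, h2, h h3⟩
  have hall := (ae_ball_iff hScount).2 fun w (_ : w ∈ S) => hret w
  obtain ⟨R, hR, hRγ, hRP⟩ := exists_isSigmaCompact_of_ae
    ((measure_eq_zero_iff_ae_notMem.1 hΓ.concentrated).and (hleb.and hall))
  refine ⟨R, ⟨fun p hp => not_not.1 (hRP p hp).1, hR, hRγ, fun p hp => (hRP p hp).2.1⟩,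
    fun x₀ y₀ y₀' h h' hne => ?_⟩
  exact exists_isFlatPart hC hΓ.cyclic hΓ.displacement hSsub hSdense
    (not_not.1 (hRP _ h).1) (not_not.1 (hRP _ h').1) hne (hRP _ h).2.2

end Graph

end ConstrainedTransport

theorem mainTheorem4 (d : ℕ) (C : Set (EuclideanSpace ℝ (Fin d)))
    (hCconvex : Convex ℝ C) (hCclosed : IsClosed C)
    (f₀ f₁ : MeasureTheory.Measure (EuclideanSpace ℝ (Fin d)))
    [MeasureTheory.IsProbabilityMeasure f₀] [MeasureTheory.IsProbabilityMeasure f₁]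
    (hf₀ : f₀ ≪ MeasureTheory.volume)
    (hfin : ∃ π, ConstrainedTransport.IsPlan f₀ f₁ π ∧ ConstrainedTransport.totalCost C π < ⊤)
    (γ : MeasureTheory.Measure (EuclideanSpace ℝ (Fin d) × EuclideanSpace ℝ (Fin d)))
    (hγ : ConstrainedTransport.IsOptimalPlan C f₀ f₁ γ) :
    (ConstrainedTransport.HasNoFlatPart C → ConstrainedTransport.IsConcentratedOnGraph f₀ γ) ∧
    (∃ Γ R : Set (EuclideanSpace ℝ (Fin d) × EuclideanSpace ℝ (Fin d)),
      ConstrainedTransport.IsMonotoneSupport C γ Γ ∧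
      ConstrainedTransport.IsLebesgueSupport γ Γ R ∧
      ∀ x₀ y₀ y₀' : EuclideanSpace ℝ (Fin d), (x₀, y₀) ∈ R → (x₀, y₀') ∈ R → y₀ ≠ y₀' →
        ∃ F : Set (EuclideanSpace ℝ (Fin d)), ConstrainedTransport.IsFlatPart F C ∧
          y₀ - x₀ ∈ F ∧ y₀' - x₀ ∈ F) := by
  obtain ⟨π, hπ, hπfin⟩ := hfin
  have := hγ.1.isProbabilityMeasure
  obtain ⟨Γ, hΓ⟩ := hγ.exists_isMonotoneSupport hCclosed ((hγ.2 π hπ).trans_lt hπfin)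
  obtain ⟨R, hR, hflat⟩ := hΓ.exists_isLebesgueSupport hCconvex hf₀ hγ.1.1
  refine ⟨fun hno => ?_, Γ, R, hΓ, hR, hflat⟩
  refine ConstrainedTransport.isConcentratedOnGraph_of_fiber_unique hγ.1.1 hR.sigmaCompact
    hR.concentrated fun x y y' h h' => ?_
  by_contra hne
  obtain ⟨F, hF, -⟩ := hflat x y y' h h' hne
  exact hno F hF
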